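/- **Setting.** An arena consists of a set $M$ of moves, a relation $\vdash$ on $M$ ("justifies"), a labelling $\lambda:M\to\{P,O\}$ with $\lambda(a)\neq\lambda(c)$ whenever $a\vdash c$, and a nonempty set $I\subseteq M$ of initial moves, all labelled $O$. A play is a finite sequence $s_0 s_1\ldots s_r$ of moves (possibly empty) with alternating labels, such that $s_0\in I$ and every $s_i$ with $i>0$ is equipped with a pointer to an earlier $s_j$ with $s_j\vdash s_i$; the pair $(s_j,s_i)$ is the edge from $s_i$. For $p\in\{P,O\}$ the $p$-view of a play is the following subsequence (with its pointers): the view of the empty sequence is empty and that of a one-move play is that move; if the last move is labelled $p$, the $p$-view of $s\,a$ is the $p$-view of $s$ followed by $a$; if the last move $a$ is not labelled $p$ and points to $s_j$, it is the $p$-view of $s_0\ldots s_j$ followed by $a$. A Player (Opponent) strategy is a set $\sigma$ of plays of even (odd) length such that $s\,a\,c\in\sigma$ implies $s\in\sigma$. Put $p=P$ for a Player strategy and $p=O$ for an Opponent strategy. The strategy is visible if, for every $s\,a\in\sigma$ with $s$ nonempty, $a$ points to a move in the $p$-view of $s$. It is bounded by $k\in\mathbb N$ if it is visible and the $p$-view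 of every play in $\sigma$ has length at most $k$. The set $\sigma\star\tau$ of interactions of a Player strategy $\sigma$ and an Opponent strategy $\tau$ consists of all $s\,a$ such that $s\,a\in\sigma$ and $s\in\tau$ if $\lambda(a)=P$, and $s\,a\in\tau$ and $s\in\sigma$ if $\lambda(a)=O$. In a play $s$, the edge $(s_{a'},s_{j})$ crosses the edge $(s_{a},s_{i})$ if $a<a'<i<j$. By backward induction, an edge is active in $s$ if every edge of $s$ crossing it is not active in $s$. The edge $e$ from $s_i$ is inactivated in $s$ by the edge $e'$ from $s_j$, written $e\rightharpoonup e'$, if $e'$ crosses $e$ and $e$ is active in $s_0\ldots s_{j-1}$. The backtracking level of $s_i$ in $s$ is $0$ if $i=0$ or $s_i$ points to $s_{i-1}$; otherwise it is $r+1$, where $r$ is the maximal length of a chain $e_1\rightharpoonup\cdots\rightharpoonup e_r\rightharpoonup e$ of edges of $s$ ending at the edge $e$ from $s_i$. The level of a play is the maximum of the levels of its moves. A bounded Player (Opponent) strategy is $n$-backtracking if $n$ is the maximum of the levels of the Player-views (Opponent-views) of its plays (the maximum over the empty set being $0$). For $a,x$ put $a_0^{x}=x$ and $a_{i+1}^{x}=a^{\,a_i^{x}}$;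 $\log$ is to base $2$, with $k\log k$ read as $0$ for $k=0$. **Theorem.** Let $\sigma$ be a Player $n$-backtracking strategy and $\tau$ an Opponent $m$-backtracking strategy over the same arena, both bounded by $k$, and let $b=\min(n,m)$. If $s=s_0s_1\ldots s_l$ is an interaction in $\sigma\star\tau$, then $$l\;\le\;k_b^{k}=\underbrace{k^{k^{\cdot^{\cdot^{k}}}}}_{b+1}\qquad\text{and}\qquad l\;\le\;2_b^{2k\log k}=\underbrace{2^{2^{\cdot^{\cdot^{2^{2k\log k}}}}}}_{b+1}.$$ Moreover, if $k\ge 2$, then $k_b^{k}\le 2_b^{2k\log k}$. -/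

import Mathlib

/-- The two participants of a game: Player and Opponent. -/
inductive Polarity where
  | P : Polarity
  | O : Polarity
  deriving DecidableEq

/-- An arena `(M, ⊢, λ, I)` with its distinguished initial move `*`. -/
structure Arena (M : Type*) where
  /-- the enabling relation `m ⊢ n`: `m` justifies `n` -/
  enables : M → M → Prop
  /-- the labelling `λ` -/
  pol : M → Polarity
  alternation : ∀ m n, enables m n → pol m ≠ pol n
  /-- the initial moves `I` -/
  init : Set M
  init_pol : ∀ m ∈ init, pol m = Polarity.O
  star : M
  star_mem : star ∈ init

/-- A move together with its pointer: the index, in the sequence where it occurs, of the earlier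
occurrence that it answers. The first move of a sequence has no pointer; there the field is required
to have the dummy value `0` (see `Arena.IsJustified`), so that a sequence with pointers has exactly
one representation. -/
structure PMove (M : Type*) where
  move : M
  ptr : ℕ

/-- Finite sequences of moves with pointers. -/
abbrev PSeq (M : Type*) := List (PMove M)

/-- The index to which the `i`-th move of `s` points. -/
def PSeq.ptrAt {M : Type*} (s : PSeq M) (i : ℕ) : ℕ :=
  ((s[i]?).map PMove.ptr).getD 0

/-- The edge from `s_i` is crossed by the edge from `s_j` in `s`: if these edges are `(s_a, s_i)`
and `(s_b, s_j)`, then `a < b < i < j`. (This never holds for `i = 0` or `j = 0`.) -/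
def PSeq.CrossedBy {M : Type*} (s : PSeq M) (i j : ℕ) : Prop :=
  s.ptrAt i < s.ptrAt j ∧ s.ptrAt j < i ∧ i < j ∧ j < s.length

/-- The edge from `s_i` is active in `s`: every edge of `s` that crosses it is inactive in `s`
(backward induction on `i`). -/
def PSeq.Active {M : Type*} (s : PSeq M) (i : ℕ) : Prop :=
  i < s.length ∧ ∀ j, i < j → j < s.length → s.CrossedBy i j → ¬ PSeq.Active s j
termination_by s.length - i
decreasing_by omega

/-- The edge from `s_j` is inactivated by the edge from `s_i` in `s`: it is crossed by it, and it
is active in the initial segment `s_0 … s_{i-1}`. -/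
def PSeq.InactivatedBy {M : Type*} (s : PSeq M) (j i : ℕ) : Prop :=
  PSeq.Active (s.take i) j ∧ s.CrossedBy j i

/-- The backtracking level in `s` of the move `s_i`: it is `0` if `i = 0` or if `s_i` points to
`s_{i-1}`; otherwise it is `r + 1`, where `r` is the greatest length of a chain of edges
`e_1, …, e_r` of `s`, each inactivated by the next one and the last one by the edge from `s_i`.
(The indices in such a chain strictly increase, so that the set of lengths is bounded.) -/
noncomputable def PSeq.moveLevel {M : Type*} (s : PSeq M) (i : ℕ) : ℕ :=
  open Classical in
  if i = 0 ∨ s.ptrAt i + 1 = i then 0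
  else sSup {r : ℕ | ∃ c : List ℕ, c.length = r ∧ List.IsChain s.InactivatedBy (c ++ [i])} + 1

/-- The backtracking level of `s`: the maximum of the backtracking levels of its moves. -/
noncomputable def PSeq.level {M : Type*} (s : PSeq M) : ℕ :=
  (Finset.range s.length).sup s.moveLevel

/-- The subsequence of `s` at the (increasing) list of indices `L`, with the pointers of `s`,
re-expressed as indices in the subsequence. -/
def PSeq.sub {M : Type*} (s : PSeq M) (L : List ℕ) : PSeq M :=
  L.filterMap fun i => (s[i]?).map fun x => ⟨x.move, L.idxOf x.ptr⟩

namespace Arena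

variable {M : Type*} (A : Arena M)

/-- Justified sequences: the first move is initial, every other move points to an earlier
occurrence of a move that justifies it. -/
def IsJustified (s : PSeq M) : Prop :=
  ∀ i x, s[i]? = some x →
    (i = 0 → x.move ∈ A.init ∧ x.ptr = 0) ∧
    (0 < i → x.ptr < i ∧ ∃ y, s[x.ptr]? = some y ∧ A.enables y.move x.move)

/-- Plays: justified sequences in which the polarities of the moves alternate. The empty sequence
counts as a play (of even length). -/
def IsPlay (s : PSeq M) : Prop :=
  A.IsJustified s ∧
    ∀ i x y, s[i]? = some x → s[i + 1]? = some y → A.pol x.move ≠ A.pol y.move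

/-- The indices, in increasing order, of the moves that form the `p`-view of the initial segment of
`s` of length `n`. If the last move `s_{n-1}` is a `p`-move, the view is the view of what precedes,
followed by that move; if it is a move of the other player pointing to `s_j`, the view is the
view of `s_0 … s_j` followed by that move; the first move is its own view. -/
def viewIdx (p : Polarity) (s : PSeq M) : ℕ → List ℕ
  | 0 => []
  | n + 1 =>
    match s[n]? with
    | none => []
    | some x =>
      if A.pol x.move = p then viewIdx p s n ++ [n]
      else if x.ptr < n then viewIdx p s (x.ptr + 1) ++ [n]
      else [n]
termination_by n => n

/-- The `p`-view of `s`, as a sequence of moves with pointers. -/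
def view (p : Polarity) (s : PSeq M) : PSeq M :=
  s.sub (A.viewIdx p s s.length)

/-- Strategies for `p`: sets of plays, of even length for Player and of odd length for Opponent,
such that `s m n ∈ σ` implies `s ∈ σ`. -/
structure IsStrategy (p : Polarity) (σ : Set (PSeq M)) : Prop where
  isPlay : ∀ s ∈ σ, A.IsPlay s
  parity : ∀ s ∈ σ, match p with
    | Polarity.P => Even s.length
    | Polarity.O => Odd s.length
  closed : ∀ s x y, s ++ [x, y] ∈ σ → s ∈ σ

/-- Visibility of a strategy for `p`: in every `s m ∈ σ` with `s` nonempty, `m` points to a move in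
the `p`-view of `s`. (For Player, `s` is automatically nonempty.) -/
def IsVisible (p : Polarity) (σ : Set (PSeq M)) : Prop :=
  ∀ s x, s ++ [x] ∈ σ → s ≠ [] → x.ptr ∈ A.viewIdx p s s.length

/-- A visible strategy for `p` is bounded by `k` if no `p`-view of a play in it is longer
than `k`. -/
def IsBounded (p : Polarity) (σ : Set (PSeq M)) (k : ℕ) : Prop :=
  A.IsVisible p σ ∧ ∀ s ∈ σ, (A.view p s).length ≤ k

/-- The backtracking level of a (bounded) strategy `σ` for `p`: the maximum of the backtracking
levels of the `p`-views of the plays in `σ` (and `0` if `σ` is empty). -/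
noncomputable def strategyLevel (p : Polarity) (σ : Set (PSeq M)) : ℕ :=
  sSup {n : ℕ | ∃ s ∈ σ, n = (A.view p s).level}

/-- The set `σ ⋆ τ` of interactions between a Player strategy `σ` and an Opponent strategy `τ`. -/
def interactions (σ τ : Set (PSeq M)) : Set (PSeq M) :=
  {t | ∃ s x, t = s ++ [x] ∧
    (A.pol x.move = Polarity.P → s ++ [x] ∈ σ ∧ s ∈ τ) ∧
    (A.pol x.move = Polarity.O → s ++ [x] ∈ τ ∧ s ∈ σ)}

end Arena

/-- The hyperexponential function `a_n^x`: `a_0^x = x` and `a_{n+1}^x = a ^ (a_n^x)`. -/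
def hyperexp {α : Type*} [Pow α α] (a x : α) : ℕ → α
  | 0 => x
  | n + 1 => a ^ hyperexp a x n

/-! Fix one player and let `E` be the set of that player's edges. The other player's view jumps over
exactly the active edges of `E`: it consists of the positions that lie strictly under no active edge
(`mem_view_iff`). At the start, boundedness of the other player says that this view has at most `k`
elements.

Now replace `E` by its derivative `der f E`, which discards the edges that inactivate nothing. The
remaining edges keep their activity (`act_der_iff`), so that the view with fewer jumps contains the
old one. An edge that survives `r` derivations ends a chain of `r` inactivations. By visibility the
whole chain can be seen in the view of the player who owns the edge (`Visible.mem_view_of_act`,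
`Restricts.exists_chain`). Hence, if `b` is the level of that player's strategy, only edges to the
immediate predecessor survive `b` derivations, and the view that jumps over these is the entire
interaction.

It remains to see that one derivation turns a bound `K` into at most `k ^ K`
(`Visible.card_view_der_le`). The positions of one parity in the derived view form a tree: the
parent of `v` is the target of the edge from `v - 1` if this edge is in `E`, and `v - 2` otherwise.
The path from `v` to the root stays in the view for `E`, so the depth is controlled by `K`. Moves
with a common target fit, together with it, into a single view of their owner
(`Visible.card_lt_of_target_eq`), so the branching is at most `k`. Exchanging the players gives the
minimum of the two levels. -/

namespace Backtracking

/-- The edge from `i` is crossed by the edge from `j`, for the pointer function `f`. -/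
def Cross (f : ℕ → ℕ) (i j : ℕ) : Prop := f i < f j ∧ f j < i ∧ i < j

/-- The edge from `i` belongs to `E` and is active among the edges of `E` that start before `n`. -/
def Act (f : ℕ → ℕ) (E : Set ℕ) (n i : ℕ) : Prop :=
  i ∈ E ∧ i < n ∧ ∀ j, i < j → j < n → Cross f i j → ¬ Act f E n j
termination_by n - i
decreasing_by omega

open Classical in
/-- The view at time `n` when exactly the edges starting in `J` are jumped over. -/
noncomputable def view (f : ℕ → ℕ) (J : Set ℕ) : ℕ → Finset ℕ
  | 0 => ∅
  | n + 1 => insert n (if n ∈ J ∧ f n < n then view f J (f n + 1) else view f J n)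
termination_by n => n

/-- The edges of `E` that inactivate some edge of `E`. -/
def der (f : ℕ → ℕ) (E : Set ℕ) : Set ℕ := {e ∈ E | ∃ d, Act f E e d ∧ Cross f d e}

/-- The positive numbers in the residue class of `c` modulo `2`. -/
def moves (c : ℕ) : Set ℕ := {i | 0 < i ∧ i % 2 = c}

variable {f : ℕ → ℕ} {E J : Set ℕ} {n i j m v x y d : ℕ}

/-! ### Active edges and the derivative of a set of edges -/

section Activity

theorem Act.mem (h : Act f E n i) : i ∈ E := by rw [Act] at h; exact h.1

theorem Act.lt (h : Act f E n i) : i < n := by rw [Act] at h; exact h.2.1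

theorem Act.not_cross (hi : Act f E n i) (hj : Act f E n j) : ¬ Cross f i j := by
  intro hc
  rw [Act] at hi
  exact hi.2.2 j hc.2.2 hj.lt hc hj

theorem act_of_forall (hE : i ∈ E) (hn : i < n) (h : ∀ j, Act f E n j → ¬ Cross f i j) :
    Act f E n i := by
  rw [Act]
  exact ⟨hE, hn, fun j _ _ hc hj => h j hj hc⟩

theorem exists_cross_of_not_act (hE : i ∈ E) (hn : i < n) (h : ¬ Act f E n i) :
    ∃ j, Act f E n j ∧ Cross f i j := by
  by_contra! hc
  exact h (act_of_forall hE hn hc)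

theorem act_succ_self (h : n ∈ E) : Act f E (n + 1) n :=
  act_of_forall h (by omega) fun j hj hc => by have := hj.lt; have := hc.2.2; omega

/-- Induction downwards from `n`. -/
theorem backward_induction {C : ℕ → Prop} (n : ℕ)
    (h : ∀ x, (∀ y, x < y → y < n → C y) → x < n → C x) : ∀ x, x < n → C x := by
  intro x hx
  induction hk : n - x using Nat.strong_induction_on generalizing x with
  | _ k ih => exact h x (fun y h1 h2 => ih (n - y) (by omega) y h2 rfl) hx

theorem act_succ_iff_of_notMem (hn : n ∉ E) : Act f E (n + 1) x ↔ Act f E n x := by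
  have key : ∀ x, x < n → (Act f E (n + 1) x ↔ Act f E n x) := by
    refine backward_induction n fun x ih hx => ⟨fun h => ?_, fun h => ?_⟩
    · refine act_of_forall h.mem hx fun y hy hc => ?_
      exact h.not_cross ((ih y hc.2.2 hy.lt).2 hy) hc
    · refine act_of_forall h.mem (by omega) fun y hy hc => ?_
      have : y ≠ n := fun e => hn (e ▸ hy.mem)
      have hyn : y < n := by have := hy.lt; omega
      exact h.not_cross ((ih y hc.2.2 hyn).1 hy) hc
  refine ⟨fun h => (key x ?_).1 h, fun h => (key x h.lt).2 h⟩
  have : x ≠ n := fun e => hn (e ▸ h.mem)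
  have := h.lt
  omega

/-- An edge from strictly between `f n` and `n` that crosses an edge from `x ≤ f n` is itself
crossed by the edge from `n`, which is active because it is the last one. So below `f n` the clock
is set back to `f n + 1`. -/
theorem act_succ_iff_of_le_ptr (hn : n ∈ E) (hf : f n < n) (hx : x ≤ f n) :
    Act f E (n + 1) x ↔ Act f E (f n + 1) x := by
  have key : ∀ x, x < f n + 1 → (Act f E (n + 1) x ↔ Act f E (f n + 1) x) := by
    refine backward_induction _ fun x ih hx => ⟨fun h => ?_, fun h => ?_⟩
    · refine act_of_forall h.mem hx fun y hy hc => ?_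
      exact h.not_cross ((ih y hc.2.2 hy.lt).2 hy) hc
    · refine act_of_forall h.mem (by omega) fun y hy hc => ?_
      by_cases hy' : y < f n + 1
      · exact h.not_cross ((ih y hc.2.2 hy').1 hy) hc
      · have h1 := hy.lt
        have h2 := hc.2.1
        rcases (show y = n ∨ y < n by omega) with rfl | h3
        · omega
        · exact hy.not_cross (act_succ_self hn) ⟨by omega, by omega, h3⟩
  exact key x (by omega)

theorem act_succ_iff_of_ptr_le (hx : f n ≤ f x) (hxn : x < n) :
    Act f E (n + 1) x ↔ Act f E n x := by
  have key : ∀ x, x < n → f n ≤ f x → (Act f E (n + 1) x ↔ Act f E n x) := by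
    refine backward_induction _ fun x ih hxn hx => ⟨fun h => ?_, fun h => ?_⟩
    · refine act_of_forall h.mem hxn fun y hy hc => ?_
      exact h.not_cross ((ih y hc.2.2 hy.lt (hx.trans hc.1.le)).2 hy) hc
    · refine act_of_forall h.mem (by omega) fun y hy hc => ?_
      have h1 := hy.lt
      have h2 := hc.1
      rcases (show y = n ∨ y < n by omega) with rfl | h3
      · omega
      · exact h.not_cross ((ih y hc.2.2 h3 (by omega)).1 hy) hc
  exact key x hxn hx

/-- Since `j` inactivates nothing, every edge from under `j` that is active at time `j` stays above
`f j`. A later active edge crossing it would then cross the edge from `j`, which is still active at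
`n`. So activity under `j` is frozen. -/
theorem act_iff_of_notMem_der (hj : j ∉ der f E) (hjn : Act f E n j) (hx : f j < x)
    (hxj : x < j) : Act f E j x ↔ Act f E n x := by
  have hj' : ∀ d, Act f E j d → ¬ Cross f d j := fun d h1 h2 => hj ⟨hjn.mem, d, h1, h2⟩
  have key : ∀ x, x < j → f j < x → (Act f E j x ↔ Act f E n x) := by
    refine backward_induction _ fun x ih hxj hx => ⟨fun h => ?_, fun h => ?_⟩
    · have hjlt := hjn.lt
      refine act_of_forall h.mem (by omega) fun y hy hc => ?_
      have h1 := hc.2.2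
      have h2 : ¬ f x < f j := fun h' => hj' x h ⟨h', hx, hxj⟩
      rcases lt_trichotomy y j with h3 | rfl | h3
      · exact h.not_cross ((ih y hc.2.2 h3 (by omega)).2 hy) hc
      · exact h2 hc.1
      · have h4 := hc.1
        have h5 := hc.2.1
        exact hjn.not_cross hy ⟨by omega, by omega, h3⟩
    · refine act_of_forall h.mem hxj fun y hy hc => ?_
      have h1 := hc.2.2
      exact h.not_cross ((ih y h1 hy.lt (by omega)).1 hy) hc
  exact key x hxj hx

/-- Take the least active `j` crossing `i`. If it is not in the derivative, then `i` was already
inactive at time `j`, because of some `y < j`. Activity under `j` being frozen, `y` is still active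
at `n`, against the choice of `j`. -/
theorem act_of_forall_der (hE : i ∈ E) (hn : i < n)
    (h : ∀ j ∈ der f E, Act f E n j → ¬ Cross f i j) : Act f E n i := by
  by_contra hi
  have hex := exists_cross_of_not_act hE hn hi
  classical
  obtain ⟨hj, hc⟩ := Nat.find_spec hex
  set j := Nat.find hex with hjdef
  have hjd : j ∉ der f E := fun hd => h j hd hj hc
  have hij : ¬ Act f E j i := fun h' => hjd ⟨hj.mem, i, h', hc⟩
  obtain ⟨y, hy, hcy⟩ := exists_cross_of_not_act hE hc.2.2 hij
  have h1 := hc.2.1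
  have h2 := hcy.2.2
  have hyn : Act f E n y := (act_iff_of_notMem_der hjd hj (by omega) hy.lt).1 hy
  exact Nat.find_min hex hy.lt ⟨hyn, hcy⟩

/-- Only crossings by edges of the derivative matter, by `act_of_forall_der`; hence activity can be
computed inside the derivative. -/
theorem act_der_iff : Act f (der f E) n i ↔ i ∈ der f E ∧ Act f E n i := by
  have key : ∀ i, i < n → (Act f (der f E) n i ↔ i ∈ der f E ∧ Act f E n i) := by
    refine backward_induction _ fun i ih hi => ⟨fun h => ⟨h.mem, ?_⟩, fun h => ?_⟩
    · refine act_of_forall_der h.mem.1 hi fun j hjd hj hc => ?_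
      exact h.not_cross ((ih j hc.2.2 hj.lt).2 ⟨hjd, hj⟩) hc
    · refine act_of_forall h.1 hi fun j hj hc => ?_
      exact h.2.not_cross ((ih j hc.2.2 hj.lt).1 hj).2 hc
  exact ⟨fun h => (key i h.lt).1 h, fun h => (key i h.2.lt).2 h⟩

theorem iterate_der_subset (r : ℕ) : (der f)^[r] E ⊆ E := by
  induction r with
  | zero => exact subset_rfl
  | succ r ih =>
    rw [Function.iterate_succ_apply']
    exact fun x hx => ih hx.1

theorem act_iterate_der_iff (r : ℕ) :
    Act f ((der f)^[r] E) n i ↔ i ∈ (der f)^[r] E ∧ Act f E n i := by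
  induction r with
  | zero => exact ⟨fun h => ⟨h.mem, h⟩, fun h => h.2⟩
  | succ r ih =>
    rw [Function.iterate_succ_apply', act_der_iff, ih]
    exact ⟨fun h => ⟨h.1, h.2.2⟩, fun h => ⟨h.1, h.1.1, h.2⟩⟩

theorem exists_of_mem_iterate_der_succ {r : ℕ} (h : i ∈ (der f)^[r + 1] E) :
    ∃ d ∈ (der f)^[r] E, Act f E i d ∧ Cross f d i := by
  rw [Function.iterate_succ_apply'] at h
  obtain ⟨-, d, h1, h2⟩ := h
  exact ⟨d, h1.mem, ((act_iterate_der_iff r).1 h1).2, h2⟩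

end Activity

/-! ### Views for an arbitrary set of jumping edges -/

section View

theorem view_succ_of_mem (hn : n ∈ J) (hf : f n < n) :
    view f J (n + 1) = insert n (view f J (f n + 1)) := by
  rw [view, if_pos ⟨hn, hf⟩]

theorem view_succ_of_notMem (hn : n ∉ J) : view f J (n + 1) = insert n (view f J n) := by
  rw [view, if_neg fun h => hn h.1]

theorem exists_view_succ (f : ℕ → ℕ) (J : Set ℕ) (n : ℕ) :
    ∃ r ≤ n, view f J (n + 1) = insert n (view f J r) ∧
      (n ∈ J ∧ f n < n ∧ r = f n + 1 ∨ ¬ (n ∈ J ∧ f n < n) ∧ r = n) := by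
  by_cases h : n ∈ J ∧ f n < n
  · exact ⟨f n + 1, h.2, by rw [view, if_pos h], .inl ⟨h.1, h.2, rfl⟩⟩
  · exact ⟨n, le_rfl, by rw [view, if_neg h], .inr ⟨h, rfl⟩⟩

theorem lt_of_mem_view (h : v ∈ view f J n) : v < n := by
  induction n using Nat.strong_induction_on with
  | _ n ih =>
    cases n with
    | zero => simp [view] at h
    | succ n =>
      obtain ⟨r, hr, e, -⟩ := exists_view_succ f J n
      rw [e, Finset.mem_insert] at h
      rcases h with rfl | h
      · omega
      · have := ih r (by omega) h
        omega

theorem self_mem_view_succ : n ∈ view f J (n + 1) := by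
  rw [view]; exact Finset.mem_insert_self _ _

/-- The recursion that computes a view, once it reaches `v`, goes on exactly as it does when started
at `v + 1`. -/
theorem mem_view_succ_iff (h : v ∈ view f J n) :
    x ∈ view f J (v + 1) ↔ x ∈ view f J n ∧ x ≤ v := by
  induction n using Nat.strong_induction_on with
  | _ n ih =>
    cases n with
    | zero => simp [view] at h
    | succ n =>
      obtain ⟨r, hr, e, -⟩ := exists_view_succ f J n
      rw [e, Finset.mem_insert] at h
      rcases h with rfl | h
      · exact ⟨fun h => ⟨h, Nat.le_of_lt_succ (lt_of_mem_view h)⟩, fun h => h.1⟩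
      · rw [ih r (by omega) h, e, Finset.mem_insert]
        have := lt_of_mem_view h
        constructor
        · exact fun h' => ⟨.inr h'.1, h'.2⟩
        · rintro ⟨rfl | h1, h2⟩
          · omega
          · exact ⟨h1, h2⟩

theorem ptr_mem_view (h : v ∈ view f J n) (hv : v ∈ J) (hf : f v < v) : f v ∈ view f J n := by
  have := (mem_view_succ_iff (x := f v) h).1 (by
    rw [view_succ_of_mem hv hf]
    exact Finset.mem_insert_of_mem self_mem_view_succ)
  exact this.1

theorem pred_mem_view (h : v + 1 ∈ view f J n) (hv : v + 1 ∉ J) : v ∈ view f J n := by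
  have := (mem_view_succ_iff (x := v) h).1 (by
    rw [view_succ_of_notMem hv]
    exact Finset.mem_insert_of_mem self_mem_view_succ)
  exact this.1

theorem le_ptr_of_mem_view (h : v ∈ view f J n) (hv : v ∈ J) (hf : f v < v)
    (hx : x ∈ view f J n) (hxv : x < v) : x ≤ f v := by
  have h1 := (mem_view_succ_iff h).2 ⟨hx, hxv.le⟩
  rw [view_succ_of_mem hv hf, Finset.mem_insert] at h1
  rcases h1 with h1 | h1
  · omega
  · have := lt_of_mem_view h1
    omega

/-- The recursion can land on `v` only from `v + 1` or by a jump to `v`. -/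
theorem succ_mem_view (h : v ∈ view f J n) (hn : v + 1 < n) (hv : ∀ i ∈ J, f i ≠ v) :
    v + 1 ∈ view f J n := by
  induction n using Nat.strong_induction_on with
  | _ n ih =>
    cases n with
    | zero => omega
    | succ n =>
      obtain ⟨r, hr, e, hc⟩ := exists_view_succ f J n
      rw [e, Finset.mem_insert] at h ⊢
      by_cases hvn : v + 1 = n
      · exact .inl hvn
      · have hvr : v ∈ view f J r := h.resolve_left (by omega)
        refine .inr (ih r (by omega) hvr ?_)
        have h1 := lt_of_mem_view hvr
        rcases hc with ⟨h2, -, h3⟩ | ⟨-, h3⟩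
        · have := hv n h2
          omega
        · omega

/-- The link between the recursive definition of views and activity: the jump from `n ∈ E` hides the
positions under this edge, and below it the active edges are those at time `f n + 1`. -/
theorem mem_view_iff (hE : ∀ i ∈ E, f i < i) :
    v ∈ view f E n ↔ v < n ∧ ∀ i, Act f E n i → ¬ (f i < v ∧ v < i) := by
  induction n using Nat.strong_induction_on generalizing v with
  | _ n ih =>
    cases n with
    | zero => simp [view]
    | succ n =>
      by_cases hn : n ∈ E
      · rw [view_succ_of_mem hn (hE n hn), Finset.mem_insert,
          ih (f n + 1) (by have := hE n hn; omega)]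
        have hfn := hE n hn
        constructor
        · rintro (rfl | ⟨h1, h2⟩)
          · exact ⟨by omega, fun i hi h => by have := hi.lt; omega⟩
          · refine ⟨by omega, fun i hi h => ?_⟩
            by_cases hi' : i ≤ f n
            · exact h2 i ((act_succ_iff_of_le_ptr hn hfn hi').1 hi) h
            · have h3 := hi.lt
              rcases (show i = n ∨ i < n by omega) with rfl | h4
              · omega
              · exact hi.not_cross (act_succ_self hn) ⟨by omega, by omega, h4⟩
        · rintro ⟨h1, h2⟩
          by_cases hvn : v = n
          · exact .inl hvn
          · have h3 := h2 n (act_succ_self hn)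
            refine .inr ⟨by omega, fun i hi h => ?_⟩
            have := hi.lt
            exact h2 i ((act_succ_iff_of_le_ptr hn hfn (by omega)).2 hi) h
      · rw [view_succ_of_notMem hn, Finset.mem_insert, ih n (by omega)]
        simp only [act_succ_iff_of_notMem hn]
        constructor
        · rintro (rfl | ⟨h1, h2⟩)
          · exact ⟨by omega, fun i hi h => by have := hi.lt; omega⟩
          · exact ⟨by omega, h2⟩
        · rintro ⟨h1, h2⟩
          by_cases hvn : v = n
          · exact .inl hvn
          · exact .inr ⟨by omega, h2⟩

theorem act_iff_of_mem_view (hE : ∀ i ∈ E, f i < i) (hv : v ∈ view f E n) (hx : x ≤ v) :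
    Act f E n x ↔ Act f E (v + 1) x := by
  induction n using Nat.strong_induction_on with
  | _ n ih =>
    cases n with
    | zero => simp [view] at hv
    | succ n =>
      obtain ⟨r, hr, e, hc⟩ := exists_view_succ f E n
      rw [e, Finset.mem_insert] at hv
      rcases hv with rfl | hv
      · rfl
      · rw [← ih r (by omega) hv]
        have h1 := lt_of_mem_view hv
        rcases hc with ⟨h2, h4, rfl⟩ | ⟨h2, rfl⟩
        · exact act_succ_iff_of_le_ptr h2 h4 (by omega)
        · exact act_succ_iff_of_notMem fun h => h2 ⟨h, hE _ h⟩

theorem view_subset_view_der (hE : ∀ i ∈ E, f i < i) :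
    view f E n ⊆ view f (der f E) n := by
  intro v
  rw [mem_view_iff hE, mem_view_iff fun i hi => hE i hi.1]
  exact fun h => ⟨h.1, fun i hi => h.2 i (act_der_iff.1 hi).2⟩

theorem view_eq_range (hE : ∀ i ∈ E, i < n → f i + 1 = i) : view f E n = Finset.range n := by
  induction n with
  | zero => simp [view]
  | succ n ih =>
    rw [Finset.range_add_one, ← ih fun i hi h => hE i hi (by omega)]
    by_cases hn : n ∈ E
    · have := hE n hn (by omega)
      rw [view_succ_of_mem hn (by omega), this]
    · exact view_succ_of_notMem hn

end View

/-! ### Visible pointers, and active edges inside views -/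

/-- Pointers of an infinite alternating sequence, visible for both players: the moves of one player
are those in the residue class of `c` modulo `2`, the moves of the other those in the class of
`c'`. -/
structure Visible (f : ℕ → ℕ) (c c' : ℕ) : Prop where
  add_eq : c + c' = 1
  ptr_lt : ∀ i, 0 < i → f i < i
  ptr_parity : ∀ i, 0 < i → (f i + i) % 2 = 1
  mem_view : ∀ i ∈ moves c, f i ∈ view f (moves c') i
  mem_view' : ∀ i ∈ moves c', f i ∈ view f (moves c) i

namespace Visible

variable {c c' : ℕ}

theorem ptr_lt' (h : Visible f c c') (hE : E ⊆ moves c) : ∀ i ∈ E, f i < i :=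
  fun i hi => h.ptr_lt i (hE hi).1

/-- An active edge over a position in the view is in the view. -/
theorem mem_view_of_act (h : Visible f c c') (hd : Act f (moves c) n d)
    (hy : y ∈ view f (moves c') n) (h1 : f d ≤ y) (h2 : y < d) : d ∈ view f (moves c') n := by
  induction n using Nat.strong_induction_on with
  | _ n ih =>
    cases n with
    | zero => exact absurd hd.lt (by omega)
    | succ n =>
      have hadd := h.add_eq
      have hdm := hd.mem
      have hdn := hd.lt
      by_cases hdn' : d = n
      · exact hdn' ▸ self_mem_view_succ
      have hfn := h.ptr_lt n (by omega)
      have hpn := h.ptr_parity n (by omega)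
      have hpd := h.ptr_parity d hdm.1
      have hd2 := hdm.2
      by_cases hn : n % 2 = c
      · have hnc : n ∈ moves c := ⟨by omega, hn⟩
        have hnc' : n ∉ moves c' := fun h' => by have := h'.2; omega
        have hfv := h.mem_view n hnc
        rw [view_succ_of_notMem hnc', Finset.mem_insert] at hy ⊢
        have hy := hy.resolve_left (by omega)
        right
        -- The last edge does not cross the active edge from `d`: either it does not reach below `f
        -- d`, or `d` lies at or below `f n`, which visibility puts into the view.
        have hnc2 := hd.not_cross (act_succ_self hnc)
        by_cases h3 : f n ≤ f d
        · exact ih n (by omega) ((act_succ_iff_of_ptr_le h3 (by omega)).1 hd) hy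
        · have h4 : d ≤ f n := by
            by_contra h5
            exact hnc2 ⟨by omega, by omega, by omega⟩
          have := ih (f n + 1) (by omega) ((act_succ_iff_of_le_ptr hnc hfn h4).1 hd)
            ((mem_view_succ_iff hfv).2 ⟨hy, by omega⟩)
          exact ((mem_view_succ_iff hfv).1 this).1
      · have hnc' : n ∈ moves c' := ⟨by omega, by omega⟩
        have hnc : n ∉ moves c := fun h' => hn h'.2
        have hfv := h.mem_view' n hnc'
        rw [view_succ_of_mem hnc' hfn, Finset.mem_insert] at hy ⊢
        have hy := hy.resolve_left (by omega)
        right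
        have hd' := (act_succ_iff_of_notMem hnc).1 hd
        have h3 := lt_of_mem_view hy
        -- By visibility of the other player no active edge passes over `f n`. As `f d ≤ y ≤ f n`,
        -- where `f d` and `f n` differ in parity, this forces `d ≤ f n`.
        have h4 := ((mem_view_iff (h.ptr_lt' subset_rfl)).1 hfv).2 d hd'
        have h5 : d ≤ f n := by omega
        exact ih (f n + 1) (by omega)
          ((act_iff_of_mem_view (h.ptr_lt' subset_rfl) hfv h5).1 hd') hy

end Visible

/-! ### Counting: one derivation costs one exponential -/

namespace Visible

variable {c c' N k K : ℕ}

open Classical in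
/-- The target of the edge from `i` if it belongs to `E`, and the predecessor of `i` otherwise. -/
noncomputable def target (f : ℕ → ℕ) (E : Set ℕ) (i : ℕ) : ℕ := if i ∈ E then f i else i - 1

theorem target_lt (h : Visible f c c') (hi : 0 < i) : target f E i < i := by
  have := h.ptr_lt i hi
  unfold target
  split_ifs <;> omega

theorem target_parity (h : Visible f c c') (hi : i ∈ moves c) : target f E i % 2 = c' := by
  have h1 := h.ptr_parity i hi.1
  have h2 := h.add_eq
  have h3 := hi.1
  have h4 := hi.2
  unfold target
  split_ifs <;> omega

theorem target_mem_view (h : Visible f c c') (hi : 0 < i)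
    (hv : i ∈ view f E n) : target f E i ∈ view f E n := by
  unfold target
  split_ifs with hiE
  · exact ptr_mem_view hv hiE (h.ptr_lt i hi)
  · obtain ⟨i, rfl⟩ : ∃ j, i = j + 1 := ⟨i - 1, by omega⟩
    exact pred_mem_view hv hiE

/-- The moves with a common target in the view of the derived edges occur, with that target, in a
single view of the player to whom the edges belong. -/
theorem card_lt_of_target_eq (h : Visible f c c') (hE : E ⊆ moves c)
    (hact : ∀ n i, Act f E n i → Act f (moves c) n i)
    (hk : ∀ j ∈ moves c, j < N → (view f (moves c') (j + 1)).card ≤ k) (hk0 : 0 < k)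
    (hn : n < N) (x : ℕ) {C : Finset ℕ} (hCv : C ⊆ view f (der f E) (n + 1))
    (hCm : ∀ j ∈ C, j ∈ moves c) (hCx : ∀ j ∈ C, target f E j = x) : C.card + 1 ≤ k := by
  rcases C.eq_empty_or_nonempty with rfl | hne
  · simpa using Nat.succ_le_of_lt hk0
  have hadd := h.add_eq
  -- The single view is the one that ends with the last of these moves.
  set e := C.max' hne with he
  have heC : e ∈ C := C.max'_mem hne
  have hem := hCm e heC
  have hex := hCx e heC
  have hev := hCv heC
  have hec' : e ∉ moves c' := fun h' => by have := h'.2; have := hem.2; omega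
  have hEd : der f E ⊆ E := fun x hx => hx.1
  have hxe : x ∈ view f (moves c') e := by
    rw [← hex]
    unfold target
    split_ifs
    · exact h.mem_view e hem
    · obtain ⟨e', he'⟩ : ∃ j, e = j + 1 := ⟨e - 1, by have := hem.1; omega⟩
      rw [he'] at hec' ⊢
      exact self_mem_view_succ
  have hmem : ∀ j ∈ C, j ∈ view f (moves c') (e + 1) := by
    intro j hj
    rcases (C.le_max' j hj).eq_or_lt with hje | hje
    · rw [hje]; exact self_mem_view_succ
    rw [← he] at hje
    rw [view_succ_of_notMem hec']
    refine Finset.mem_insert_of_mem ?_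
    have hjm := hCm j hj
    have hjx := hCx j hj
    have hjt := h.target_lt (E := E) hjm.1
    by_cases hjE : j ∈ E
    · have hjx' : f j = x := by rw [← hjx, target, if_pos hjE]
      -- Otherwise `x = e - 1 ≥ j`, whereas `x = f j < j`.
      have heE : e ∈ E := by
        by_contra heE
        rw [target, if_neg heE] at hex
        omega
      have hex' : f e = x := by rw [← hex, target, if_pos heE]
      -- If `e` were in the derivative, the view would jump from `e` to `x` and miss `j`.
      have hed : e ∉ der f E := fun hed => by
        have := le_ptr_of_mem_view hev hed (h.ptr_lt e hem.1) (hCv hj) hje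
        omega
      have hjv : j ∈ view f (der f E) e := by
        have := (mem_view_succ_iff hev).2 ⟨hCv hj, hje.le⟩
        rw [view_succ_of_notMem hed, Finset.mem_insert] at this
        exact this.resolve_left hje.ne
      -- Being in the derived view, `j` lies under no active edge of the derivative; so nothing
      -- inactivates it.
      have hja : Act f E e j := act_of_forall_der hjE hje fun i hi hai hc =>
        ((mem_view_iff (h.ptr_lt' (hEd.trans hE))).1 hjv).2 i (act_der_iff.2 ⟨hi, hai⟩)
          ⟨hc.2.1, hc.2.2⟩
      exact h.mem_view_of_act (hact _ _ hja) hxe hjx'.le (by omega)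
    · have hjx' : j = x + 1 := by
        rw [target, if_neg hjE] at hjx
        have := hjm.1
        omega
      -- No edge of the other player points to `x`, for reasons of parity; so a view containing `x`
      -- contains `x + 1`.
      rw [hjx']
      refine succ_mem_view hxe (by omega) fun i hi hix => ?_
      have h1 := h.ptr_parity i hi.1
      have h2 := hi.2
      have h3 := hjm.2
      omega
  have hxC : x ∉ C := fun hxC => by
    have h1 := h.target_parity (E := E) hem
    have h2 := (hCm x hxC).2
    omega
  -- The target itself takes up one place in the view, which leaves at most `k - 1` moves.
  have hsub : insert x C ⊆ view f (moves c') (e + 1) := by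
    intro j hj
    rcases Finset.mem_insert.1 hj with rfl | hj
    · rw [view_succ_of_notMem hec']
      exact Finset.mem_insert_of_mem hxe
    · exact hmem j hj
  have h1 := Finset.card_le_card hsub
  rw [Finset.card_insert_of_notMem hxC] at h1
  have h2 := lt_of_mem_view hev
  exact h1.trans (hk e hem (by omega))

/-- The count of tree nodes by depth. The root is `c'`, the least index of its parity; it is
inserted by hand since the view need not contain it. The size of the view for `E` measures the
depth. -/
theorem card_filter_view_der_le (h : Visible f c c') (hE : E ⊆ moves c)
    (hact : ∀ n i, Act f E n i → Act f (moves c) n i)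
    (hk : ∀ j ∈ moves c, j < N → (view f (moves c') (j + 1)).card ≤ k) (hk0 : 0 < k)
    (hn : n < N) (d : ℕ) :
    (insert c' {v ∈ view f (der f E) (n + 1) |
      v % 2 = c' ∧ (view f E (v + 1)).card ≤ d + 1}).card ≤ k ^ d := by
  have hadd := h.add_eq
  have hpos : ∀ v, v % 2 = c' → v ≠ c' → 2 ≤ v := fun v h1 h2 => by omega
  have hnE : ∀ v, v % 2 = c' → v ∉ E := fun v h1 h2 => by have := (hE h2).2; omega
  have hpm : ∀ v, v % 2 = c' → v ≠ c' → v - 1 ∈ moves c := fun v h1 h2 => by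
    have := hpos v h1 h2
    exact ⟨by omega, by omega⟩
  have hpred : ∀ v, v % 2 = c' → v ≠ c' → ∀ n J, J ⊆ E → v ∈ view f J n →
      v - 1 ∈ view f J n := by
    intro v h1 h2 n J hJ hv
    have := hpos v h1 h2
    refine pred_mem_view (v := v - 1) ?_ fun h' => hnE v h1 (hJ ?_)
    · rwa [show v - 1 + 1 = v by omega]
    · rwa [show v - 1 + 1 = v by omega] at h'
  induction d with
  | zero =>
    rw [pow_zero, Finset.card_le_one_iff_subset_singleton]
    -- Any other position `v` of this parity has both `v` and `v - 1` in its view.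
    refine ⟨c', Finset.insert_subset (by simp) fun v hv => ?_⟩
    obtain ⟨-, h1, h2⟩ := Finset.mem_filter.1 hv
    rw [Finset.mem_singleton]
    by_contra h3
    have h4 := hpos v h1 h3
    have h5 := Finset.card_le_one.1 h2 v self_mem_view_succ (v - 1)
      (hpred v h1 h3 _ _ subset_rfl self_mem_view_succ)
    omega
  | succ d ih =>
    set T : ℕ → Finset ℕ := fun d => insert c' {v ∈ view f (der f E) (n + 1) |
      v % 2 = c' ∧ (view f E (v + 1)).card ≤ d + 1} with hT
    change (T d).card ≤ k ^ d at ih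
    change (T (d + 1)).card ≤ k ^ (d + 1)
    have hmemT : ∀ d v, v ∈ T d ↔ v = c' ∨ v ∈ view f (der f E) (n + 1) ∧ v % 2 = c' ∧
        (view f E (v + 1)).card ≤ d + 1 := fun d v => by
      rw [hT, Finset.mem_insert, Finset.mem_filter]
    -- Passing to the parent shortens the view for `E`, since the parent is an earlier element of
    -- it.
    have hmaps : ∀ v ∈ T (d + 1),
        (if v = c' then c' else target f E (v - 1)) ∈ T d := by
      intro v hv
      split_ifs with h3
      · exact Finset.mem_insert_self _ _
      · obtain ⟨hv1, hv2, hv3⟩ := ((hmemT _ _).1 hv).resolve_left h3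
        have h4 := hpm v hv2 h3
        have h5 : target f E (v - 1) ∈ view f E (v + 1) :=
          h.target_mem_view h4.1 (hpred v hv2 h3 _ _ subset_rfl self_mem_view_succ)
        have h6 := h.target_lt (E := E) h4.1
        refine (hmemT _ _).2 (.inr ⟨?_, h.target_parity h4, ?_⟩)
        · exact ((mem_view_succ_iff hv1).1 (view_subset_view_der (h.ptr_lt' hE) h5)).1
        · have h7 : view f E (target f E (v - 1) + 1) ⊂ view f E (v + 1) := by
            refine (Finset.ssubset_iff_of_subset fun x hx => ((mem_view_succ_iff h5).1 hx).1).2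
              ⟨v, self_mem_view_succ, fun h' => ?_⟩
            have := lt_of_mem_view h'
            omega
          have := Finset.card_lt_card h7
          omega
    rw [pow_succ']
    refine (Finset.card_le_mul_card_image_of_maps_to hmaps k fun x _ => ?_).trans
      (Nat.mul_le_mul_left k ih)
    set C : Finset ℕ := {j ∈ view f (der f E) (n + 1) | j % 2 = c ∧ 0 < j ∧ target f E j = x}
      with hC
    have hCk : C.card + 1 ≤ k := by
      refine h.card_lt_of_target_eq hE hact hk hk0 hn x (Finset.filter_subset _ _)
        (fun j hj => ?_) (fun j hj => ?_)
      · have := (Finset.mem_filter.1 hj).2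
        exact ⟨this.2.1, this.1⟩
      · exact (Finset.mem_filter.1 hj).2.2.2
    -- The root is its own parent, and so may be an additional element of a fibre; the `+ 1` in
    -- `hCk` makes room for it.
    refine (Finset.card_le_card (t := insert c' (C.image (· + 1))) fun v hv => ?_).trans
      ((Finset.card_insert_le _ _).trans ((Nat.succ_le_succ Finset.card_image_le).trans hCk))
    obtain ⟨hv, hvx⟩ := Finset.mem_filter.1 hv
    rw [Finset.mem_insert]
    by_cases h3 : v = c'
    · exact .inl h3
    · obtain ⟨hv1, hv2, hv3⟩ := ((hmemT _ _).1 hv).resolve_left h3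
      have h4 := hpm v hv2 h3
      have h5 := hpos v hv2 h3
      rw [if_neg h3] at hvx
      refine .inr (Finset.mem_image.2 ⟨v - 1, Finset.mem_filter.2 ⟨?_, h4.2, h4.1, hvx⟩, by omega⟩)
      exact hpred v hv2 h3 _ _ (fun x hx => hx.1) hv1

/-- The tree accounts for one parity. The other parity is no more numerous, as each of its positions
is followed in the view by its successor; the resulting factor `2` is absorbed by `k`. -/
theorem card_view_der_le (h : Visible f c c') (hE : E ⊆ moves c)
    (hact : ∀ n i, Act f E n i → Act f (moves c) n i)
    (hk : ∀ j ∈ moves c, j < N → (view f (moves c') (j + 1)).card ≤ k) (hk2 : 2 ≤ k)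
    (hK : ∀ v < N, v % 2 = c' → (view f E (v + 1)).card ≤ K) (hn : n < N) (hnc : n % 2 = c') :
    (view f (der f E) (n + 1)).card ≤ k ^ K := by
  have hadd := h.add_eq
  have hK1 : 1 ≤ K := (Finset.card_pos.2 ⟨n, self_mem_view_succ⟩).trans_le (hK n hn hnc)
  set V := view f (der f E) (n + 1) with hV
  have hQ : (V.filter fun v => v % 2 = c').card ≤ k ^ (K - 1) := by
    refine (Finset.card_le_card fun v hv => ?_).trans
      (h.card_filter_view_der_le hE hact hk (by omega) hn (K - 1))
    obtain ⟨hv1, hv2⟩ := Finset.mem_filter.1 hv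
    have h1 := lt_of_mem_view hv1
    have h2 := hK v (by omega) hv2
    exact Finset.mem_insert_of_mem (Finset.mem_filter.2 ⟨hv1, hv2, by omega⟩)
  have hP : (V.filter fun v => ¬ v % 2 = c').card ≤ (V.filter fun v => v % 2 = c').card := by
    refine Finset.card_le_card_of_injOn (· + 1) (fun v hv => ?_) fun _ _ _ _ h => by simpa using h
    obtain ⟨hv1, hv2⟩ := Finset.mem_filter.1 hv
    have h1 := lt_of_mem_view hv1
    have h2 : v ≠ n := fun e => hv2 (e ▸ hnc)
    -- Edges of `E` point to positions of parity `c'`, hence never to `v`; and `v ≠ n` keeps the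
    -- successor in range.
    refine Finset.mem_coe.2 (Finset.mem_filter.2 ⟨succ_mem_view hv1 (by omega) ?_, by grind⟩)
    intro i hi hiv
    have h3 := hE hi.1
    have h4 := h.ptr_parity i h3.1
    have h5 := h3.2
    omega
  calc V.card = (V.filter fun v => v % 2 = c').card + (V.filter fun v => ¬ v % 2 = c').card :=
        (Finset.card_filter_add_card_filter_not _).symm
    _ ≤ 2 * k ^ (K - 1) := by omega
    _ ≤ k * k ^ (K - 1) := Nat.mul_le_mul_right _ hk2
    _ = k ^ K := by rw [← pow_succ', show K - 1 + 1 = K by omega]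

/-- The views that jump over the edges of the `b`-th derivative are hyperexponentially bounded. -/
theorem card_view_iterate_der_le (h : Visible f c c')
    (hk : ∀ j ∈ moves c, j < N → (view f (moves c') (j + 1)).card ≤ k) (hk2 : 2 ≤ k)
    (hk' : ∀ v < N, v % 2 = c' → (view f (moves c) (v + 1)).card ≤ k) (b : ℕ) :
    ∀ v < N, v % 2 = c' →
      (view f ((der f)^[b] (moves c)) (v + 1)).card ≤ hyperexp k k b := by
  induction b with
  | zero => exact hk'
  | succ b ih =>
    intro v hv hvc
    rw [Function.iterate_succ_apply']
    exact h.card_view_der_le (iterate_der_subset b) (fun n i hi => ((act_iterate_der_iff b).1 hi).2)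
      hk hk2 ih hv hvc

theorem length_le_hyperexp (h : Visible f c c') {l : ℕ}
    (hk : ∀ j ∈ moves c, j < l + 1 → (view f (moves c') (j + 1)).card ≤ k) (hk2 : 2 ≤ k)
    (hk' : ∀ v < l + 1, v % 2 = c' → (view f (moves c) (v + 1)).card ≤ k) {b : ℕ}
    (hb : ∀ e ∈ (der f)^[b] (moves c), e < l + 1 → f e + 1 = e) :
    l ≤ hyperexp k k b := by
  have key : ∀ v < l + 1, v % 2 = c' → v + 1 ≤ hyperexp k k b := fun v hv hvc => by
    have := h.card_view_iterate_der_le hk hk2 hk' b v hv hvc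
    rwa [view_eq_range fun e he hev => hb e he (by omega), Finset.card_range] at this
  have hadd := h.add_eq
  -- The view bounds hold at positions of parity `c'` only. If `l` has the other parity, the
  -- position `l - 1` is used, and the bound for `l` is then all that is left.
  by_cases hl : l % 2 = c'
  · have := key l (by omega) hl
    omega
  · rcases Nat.eq_zero_or_pos l with rfl | hl0
    · exact Nat.zero_le _
    · have := key (l - 1) (by omega) (by omega)
      omega

end Visible

/-! ### Positions in increasing lists of indices -/

section Sorted

variable {L : List ℕ}

theorem idxOf_lt_idxOf_iff (hL : L.SortedLT) (hx : x ∈ L) (hy : y ∈ L) :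
    L.idxOf x < L.idxOf y ↔ x < y := by
  have h := hL.getElem_lt_getElem_iff (hi := List.idxOf_lt_length_iff.2 hx)
    (hj := List.idxOf_lt_length_iff.2 hy)
  rw [List.getElem_idxOf, List.getElem_idxOf] at h
  exact h.symm

theorem exists_idxOf_eq (hL : L.SortedLT) (h : i < L.length) : ∃ x ∈ L, L.idxOf x = i :=
  ⟨L[i], List.getElem_mem h, hL.nodup.idxOf_getElem i h⟩

end Sorted

/-! ### Backtracking levels of views as subsequences -/

section Sequences

variable {M : Type*} {t : PSeq M}

theorem ptrAt_take {b : ℕ} (h : i < b) : PSeq.ptrAt (t.take b) i = t.ptrAt i := by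
  unfold PSeq.ptrAt
  rw [List.getElem?_take_of_lt h]

theorem crossedBy_take_iff {b : ℕ} :
    PSeq.CrossedBy (t.take b) i j ↔ j < b ∧ t.CrossedBy i j := by
  unfold PSeq.CrossedBy
  rw [List.length_take]
  by_cases hj : j < b
  · by_cases hij : i < j
    · rw [ptrAt_take hj, ptrAt_take (hij.trans hj)]
      omega
    · omega
  · omega

theorem chain_sorted {c : List ℕ} (h : List.IsChain t.InactivatedBy c) : c.SortedLT := by
  have : List.IsChain (· < ·) c := h.imp fun a b hab => hab.2.2.2.1
  exact this.sortedLT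

theorem length_le_of_chain {c : List ℕ} (h : List.IsChain t.InactivatedBy (c ++ [i])) :
    c.length ≤ i := by
  have hs := chain_sorted h
  have hs' := List.pairwise_append.1 hs.pairwise
  have hc : c.toFinset ⊆ Finset.range i := fun x hx =>
    Finset.mem_range.2 (hs'.2.2 x (List.mem_toFinset.1 hx) i (by simp))
  have := Finset.card_le_card hc
  rwa [Finset.card_range, List.toFinset_card_of_nodup (hs'.1.imp ne_of_lt)] at this

theorem bddAbove_chain_length (t : PSeq M) (i : ℕ) :
    BddAbove {r : ℕ | ∃ c : List ℕ, c.length = r ∧ List.IsChain t.InactivatedBy (c ++ [i])} :=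
  ⟨i, by rintro r ⟨c, rfl, hc⟩; exact length_le_of_chain hc⟩

theorem moveLevel_le (t : PSeq M) (i : ℕ) : t.moveLevel i ≤ i + 1 := by
  unfold PSeq.moveLevel
  split_ifs
  · omega
  · refine Nat.succ_le_succ (csSup_le' ?_)
    rintro r ⟨c, rfl, hc⟩
    exact length_le_of_chain hc

theorem level_le_length (t : PSeq M) : t.level ≤ t.length :=
  Finset.sup_le fun i hi => (moveLevel_le t i).trans (Finset.mem_range.1 hi)

theorem lt_level_of_chain {c : List ℕ} (hi : i < t.length) (hi0 : i ≠ 0) (hp : t.ptrAt i + 1 ≠ i)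
    (hc : List.IsChain t.InactivatedBy (c ++ [i])) : c.length < t.level := by
  have h1 : t.moveLevel i ≤ t.level :=
    Finset.le_sup (f := t.moveLevel) (Finset.mem_range.2 hi)
  have h2 : c.length + 1 ≤ t.moveLevel i := by
    unfold PSeq.moveLevel
    rw [if_neg (by tauto)]
    exact Nat.succ_le_succ (le_csSup (bddAbove_chain_length t i) ⟨c, rfl, hc⟩)
  omega

/-- `t` is the subsequence, at the indices in `L`, of a sequence with pointers `f`. -/
structure Restricts (t : PSeq M) (f : ℕ → ℕ) (L : List ℕ) : Prop where
  sorted : L.SortedLT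
  map_ptr : t.map PMove.ptr = L.map fun i => L.idxOf (f i)

namespace Restricts

variable {L : List ℕ} {c c' e k : ℕ}

theorem length_eq (ht : Restricts t f L) : t.length = L.length := by
  simpa using congrArg List.length ht.map_ptr

theorem ptrAt_idxOf (ht : Restricts t f L) (hx : x ∈ L) :
    t.ptrAt (L.idxOf x) = L.idxOf (f x) := by
  unfold PSeq.ptrAt
  rw [← List.getElem?_map, ht.map_ptr, List.getElem?_map, List.getElem?_idxOf hx]
  rfl

variable (h : Visible f c c') (ht : Restricts t f L)
  (hL : ∀ i, i ∈ L ↔ i ∈ view f (moves c') (e + 1))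

-- Pointers of the player who owns the view stay in it by visibility; those of the other player are
-- the jumps of the view.
include h hL in
theorem ptr_mem (hx : x ∈ L) (hx0 : 0 < x) : f x ∈ L := by
  rw [hL] at hx ⊢
  have hadd := h.add_eq
  by_cases hc : x ∈ moves c'
  · exact ptr_mem_view hx hc (h.ptr_lt x hx0)
  · have h1 : x % 2 = c := by
      by_contra h1
      exact hc ⟨hx0, by omega⟩
    have h2 : f x ∈ view f (moves c') (x + 1) := by
      rw [view_succ_of_notMem hc]
      exact Finset.mem_insert_of_mem (h.mem_view x ⟨hx0, h1⟩)
    exact ((mem_view_succ_iff hx).1 h2).1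

include h ht hL in
theorem crossedBy_iff (hx : x ∈ L) (hx0 : 0 < x) (hy : y ∈ L) (hy0 : 0 < y) :
    t.CrossedBy (L.idxOf x) (L.idxOf y) ↔ Cross f x y := by
  have hfx := ptr_mem h hL hx hx0
  have hfy := ptr_mem h hL hy hy0
  have := List.idxOf_lt_length_iff.2 hy
  unfold PSeq.CrossedBy Cross
  rw [ht.ptrAt_idxOf hx, ht.ptrAt_idxOf hy, idxOf_lt_idxOf_iff ht.sorted hfx hfy,
    idxOf_lt_idxOf_iff ht.sorted hfy hx, idxOf_lt_idxOf_iff ht.sorted hx hy, ht.length_eq]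
  tauto

include h ht hL in
/-- An edge in the view is active there exactly if it is active in the whole sequence. -/
theorem active_iff (hy : y ∈ L) (hyc : y ∈ moves c) :
    ∀ x, x < y → x ∈ L → x ∈ moves c →
      (PSeq.Active (t.take (L.idxOf y)) (L.idxOf x) ↔ Act f (moves c) y x) := by
  have hadd := h.add_eq
  refine backward_induction _ fun x ih hxy hx hxc => ?_
  have hxi := (idxOf_lt_idxOf_iff ht.sorted hx hy).2 hxy
  have hlen : (t.take (L.idxOf y)).length = L.idxOf y := by
    have := List.idxOf_lt_length_iff.2 hy
    rw [List.length_take, ht.length_eq]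
    omega
  have hyc' : y ∉ moves c' := fun h' => by have := h'.2; have := hyc.2; omega
  have hmem : ∀ z, z ∈ view f (moves c') y ↔ z ∈ L ∧ z < y := fun z => by
    have h1 := mem_view_succ_iff (x := z) ((hL y).1 hy)
    rw [view_succ_of_notMem hyc', Finset.mem_insert, ← hL] at h1
    constructor
    · intro hz
      exact ⟨(h1.1 (.inr hz)).1, lt_of_mem_view hz⟩
    · rintro ⟨hz1, hz2⟩
      exact (h1.2 ⟨hz1, hz2.le⟩).resolve_left hz2.ne
  constructor
  · intro ha
    by_contra hna
    obtain ⟨q, hq, hc⟩ := exists_cross_of_not_act hxc hxy hna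
    have hxv : x ∈ view f (moves c') y := (hmem x).2 ⟨hx, hxy⟩
    obtain ⟨x', rfl⟩ : ∃ z, x = z + 1 := ⟨x - 1, by have := hxc.1; omega⟩
    have hx' : x' ∈ view f (moves c') y :=
      pred_mem_view hxv fun h' => by have := h'.2; have := hxc.2; omega
    have h1 := hc.2.1
    have h2 := hc.2.2
    -- The active edge from `q` spans `x'`, which is in the view; hence the view contains `q`.
    have hqL := ((hmem q).1 (h.mem_view_of_act hq hx' (by omega) (by omega))).1
    have hqi := (idxOf_lt_idxOf_iff ht.sorted hqL hy).2 hq.lt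
    rw [PSeq.Active] at ha
    refine ha.2 (L.idxOf q) ((idxOf_lt_idxOf_iff ht.sorted hx hqL).2 h2) (by rwa [hlen])
      (crossedBy_take_iff.2 ⟨hqi, (ht.crossedBy_iff h hL hx hxc.1 hqL hq.mem.1).2 hc⟩) ?_
    exact (ih q h2 hq.lt hqL hq.mem).2 hq
  · intro ha
    rw [PSeq.Active]
    refine ⟨by rwa [hlen], fun j hxj hj hc hja => ?_⟩
    rw [hlen] at hj
    obtain ⟨q, hqL, rfl⟩ := exists_idxOf_eq ht.sorted (hj.trans (List.idxOf_lt_length_iff.2 hy))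
    have hxq := (idxOf_lt_idxOf_iff ht.sorted hx hqL).1 hxj
    have hqy := (idxOf_lt_idxOf_iff ht.sorted hqL hy).1 hj
    have hc' := (ht.crossedBy_iff h hL hx hxc.1 hqL (by omega)).1 (crossedBy_take_iff.1 hc).2
    by_cases hqc : q ∈ moves c
    · exact ha.not_cross ((ih q hxq hqy hqL hqc).1 hja) hc'
    · have hqc' : q ∈ moves c' := ⟨by omega, by
        by_contra h'
        exact hqc ⟨by omega, by omega⟩⟩
      -- A view jumps over the edges of the other player, so such an edge has no position of the
      -- view under it and crosses nothing there.
      have h1 := le_ptr_of_mem_view ((hL q).1 hqL) hqc' (h.ptr_lt q (by omega)) ((hL x).1 hx) hxq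
      have h2 := hc'.2.1
      omega

-- Each derivation provides one more inactivated edge. It spans the target of the edge that
-- inactivates it, a position in the view by visibility, so it is in the view too and the chain can
-- be read off there.
include h ht hL in
theorem exists_chain (r : ℕ) : ∀ i ∈ L, i ∈ (der f)^[r] (moves c) →
    ∃ l : List ℕ, l.length = r ∧ List.IsChain t.InactivatedBy (l ++ [L.idxOf i]) := by
  have hadd := h.add_eq
  induction r with
  | zero => exact fun i _ _ => ⟨[], rfl, by simp⟩
  | succ r ih =>
    intro i hiL hi
    have hic : i ∈ moves c := iterate_der_subset _ hi
    obtain ⟨d, hd, hda, hdi⟩ := exists_of_mem_iterate_der_succ hi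
    have h1 := h.mem_view_of_act hda (h.mem_view i hic) hdi.1.le hdi.2.1
    have hdL : d ∈ L := by
      have h2 : d ∈ view f (moves c') (i + 1) := by
        rw [view_succ_of_notMem fun h' => by have := h'.2; have := hic.2; omega]
        exact Finset.mem_insert_of_mem h1
      exact (hL d).2 ((mem_view_succ_iff ((hL i).1 hiL)).1 h2).1
    obtain ⟨l, hl, hch⟩ := ih d hdL hd
    refine ⟨l ++ [L.idxOf d], by simp [hl], ?_⟩
    rw [List.isChain_append]
    refine ⟨hch, by simp, ?_⟩
    simp only [List.getLast?_append, List.getLast?_singleton, List.head?_singleton, Option.mem_def,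
      Option.some_or, Option.some.injEq]
    rintro _ rfl _ rfl
    exact ⟨(ht.active_iff h hL hiL hic d hdi.2.2 hdL hda.mem).2 hda,
      (ht.crossedBy_iff h hL hdL hda.mem.1 hiL hic.1).2 hdi⟩

include h ht hL in
/-- Edges of the `b`-th derivative are trivial if the view that they close has level `b`. -/
theorem ptr_succ_eq {b : ℕ} (hb : t.level ≤ b) (he : e ∈ (der f)^[b] (moves c)) : f e + 1 = e := by
  have hec : e ∈ moves c := iterate_der_subset _ he
  have hadd := h.add_eq
  have heL : e ∈ L := (hL e).2 self_mem_view_succ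
  have hfe := ptr_mem h hL heL hec.1
  have hlt := h.ptr_lt e hec.1
  by_contra hne
  obtain ⟨l, hl, hch⟩ := ht.exists_chain h hL b e heL he
  have h1 : L.idxOf (f e) < L.idxOf e := (idxOf_lt_idxOf_iff ht.sorted hfe heL).2 hlt
  obtain ⟨e', rfl⟩ : ∃ z, e = z + 1 := ⟨e - 1, by have := hec.1; omega⟩
  have he'L : e' ∈ L := by
    rw [hL] at heL ⊢
    exact pred_mem_view heL fun h' => by have := h'.2; have := hec.2; omega
  -- The view contains `e - 1` as well as `f e` and `e`; hence an edge that is not trivial in the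
  -- sequence is not trivial in the view either, and has positive level there.
  have h2 : L.idxOf (f (e' + 1)) < L.idxOf e' :=
    (idxOf_lt_idxOf_iff ht.sorted hfe he'L).2 (by omega)
  have h3 : L.idxOf e' < L.idxOf (e' + 1) :=
    (idxOf_lt_idxOf_iff ht.sorted he'L heL).2 (by omega)
  have := lt_level_of_chain (t := t) (i := L.idxOf (e' + 1))
    (by rw [ht.length_eq]; exact List.idxOf_lt_length_iff.2 heL) (by omega)
    (by rw [ht.ptrAt_idxOf heL]; omega) hch
  omega

end Restricts

end Sequences

end Backtracking

/-! ### From plays and strategies to pointer functions -/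

namespace Backtracking

variable {M : Type*} {A : Arena M} {p q : Polarity} {s : PSeq M} {i j n m k : ℕ}

/-- The pointers of `s`, continued by trivial pointers after the end of `s`. -/
def ptr (s : PSeq M) (i : ℕ) : ℕ := if i < s.length then s.ptrAt i else i - 1

/-- The residue class modulo `2` of the indices of the moves of a player. -/
def residue : Polarity → ℕ
  | Polarity.P => 1
  | Polarity.O => 0

theorem residue_add (h : p ≠ q) : residue p + residue q = 1 := by
  cases p <;> cases q <;> simp_all [residue]

theorem ptr_eq_of_lt (h : i < s.length) : ptr s i = (s[i]).ptr := by
  rw [ptr, if_pos h, PSeq.ptrAt, List.getElem?_eq_getElem h]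
  rfl

section Plays

theorem pol_eq_iff (hs : A.IsPlay s) (h : i < s.length) :
    A.pol (s[i]).move = p ↔ i % 2 = residue p := by
  have key : ∀ i (h : i < s.length),
      A.pol (s[i]).move = if i % 2 = 0 then Polarity.O else Polarity.P := by
    intro i
    induction i with
    | zero =>
      intro h
      exact A.init_pol _ ((hs.1 0 _ (List.getElem?_eq_getElem h)).1 rfl).1
    | succ i ih =>
      intro h
      have h1 := ih (by omega)
      have h2 := hs.2 i _ _ (List.getElem?_eq_getElem (by omega)) (List.getElem?_eq_getElem h)
      rw [h1] at h2
      rcases Nat.mod_two_eq_zero_or_one i with h3 | h3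
      · rw [if_neg (by omega)]
        rw [if_pos h3] at h2
        cases h4 : A.pol (s[i + 1]).move <;> simp_all
      · rw [if_pos (by omega)]
        rw [if_neg (by omega)] at h2
        cases h4 : A.pol (s[i + 1]).move <;> simp_all
  rw [key i h]
  rcases Nat.mod_two_eq_zero_or_one i with h3 | h3 <;> cases p <;> simp [h3, residue]

theorem ptr_lt (hs : A.IsPlay s) (hi : 0 < i) : ptr s i < i := by
  by_cases h : i < s.length
  · rw [ptr_eq_of_lt h]
    exact ((hs.1 i _ (List.getElem?_eq_getElem h)).2 hi).1
  · rw [ptr, if_neg h]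
    omega

theorem ptr_parity (hs : A.IsPlay s) (hi : 0 < i) : (ptr s i + i) % 2 = 1 := by
  by_cases h : i < s.length
  · rw [ptr_eq_of_lt h]
    obtain ⟨h1, y, hy, he⟩ := (hs.1 i _ (List.getElem?_eq_getElem h)).2 hi
    have h2 := A.alternation _ _ he
    rw [List.getElem?_eq_getElem (h1.trans h), Option.some.injEq] at hy
    subst hy
    have h3 := (pol_eq_iff hs (h1.trans h) (p := A.pol (s[i]).move)).not.1 h2
    have h4 := (pol_eq_iff hs h).1 rfl
    omega
  · rw [ptr, if_neg h]
    omega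

theorem viewIdx_take (hnm : n ≤ m) : A.viewIdx p (s.take m) n = A.viewIdx p s n := by
  induction n using Nat.strong_induction_on with
  | _ n ih =>
    cases n with
    | zero => rw [Arena.viewIdx, Arena.viewIdx]
    | succ n =>
      rw [Arena.viewIdx, Arena.viewIdx, List.getElem?_take_of_lt (by omega)]
      cases s[n]? with
      | none => rfl
      | some x =>
        dsimp only
        split_ifs with h1 h2
        · rw [ih n (by omega) (by omega)]
        · rw [ih (x.ptr + 1) (by omega) (by omega)]
        · rfl

theorem viewIdx_succ (hs : A.IsPlay s) (hpq : p ≠ q) (hn : n < s.length) :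
    ∃ r ≤ n, A.viewIdx p s (n + 1) = A.viewIdx p s r ++ [n] ∧
      view (ptr s) (moves (residue q)) (n + 1) =
        insert n (view (ptr s) (moves (residue q)) r) := by
  have hadd := residue_add hpq
  have hpol := pol_eq_iff (p := p) hs hn
  by_cases h : n % 2 = residue p
  · refine ⟨n, le_rfl, ?_, view_succ_of_notMem fun h' => by have := h'.2; omega⟩
    rw [Arena.viewIdx, List.getElem?_eq_getElem hn]
    exact if_pos (hpol.2 h)
  · rcases Nat.eq_zero_or_pos n with rfl | hn0
    · refine ⟨0, le_rfl, ?_, view_succ_of_notMem fun h' => by have := h'.1; omega⟩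
      rw [Arena.viewIdx.eq_def A p s 0, Arena.viewIdx, List.getElem?_eq_getElem hn]
      dsimp only
      rw [if_neg (hpol.not.2 h), if_neg (Nat.not_lt_zero _)]
      rfl
    · have hlt := ptr_lt hs hn0
      refine ⟨ptr s n + 1, hlt, ?_, view_succ_of_mem ⟨hn0, by omega⟩ hlt⟩
      rw [ptr_eq_of_lt hn] at hlt ⊢
      rw [Arena.viewIdx, List.getElem?_eq_getElem hn]
      dsimp only
      rw [if_neg (hpol.not.2 h), if_pos hlt]

theorem mem_viewIdx_iff (hs : A.IsPlay s) (hpq : p ≠ q) (hn : n ≤ s.length) (i : ℕ) :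
    i ∈ A.viewIdx p s n ↔ i ∈ view (ptr s) (moves (residue q)) n := by
  induction n using Nat.strong_induction_on with
  | _ n ih =>
    cases n with
    | zero => simp [Arena.viewIdx, view]
    | succ n =>
      obtain ⟨r, hr, h1, h2⟩ := viewIdx_succ hs hpq (n := n) (by omega)
      rw [h1, h2, List.mem_append, List.mem_singleton, Finset.mem_insert,
        ih r (by omega) (by omega), or_comm]

theorem sortedLT_viewIdx (hs : A.IsPlay s) (hpq : p ≠ q) (hn : n ≤ s.length) :
    (A.viewIdx p s n).SortedLT := by
  induction n using Nat.strong_induction_on with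
  | _ n ih =>
    cases n with
    | zero =>
      rw [Arena.viewIdx]
      exact List.Pairwise.nil.sortedLT
    | succ n =>
      obtain ⟨r, hr, h1, h2⟩ := viewIdx_succ hs hpq (n := n) (by omega)
      rw [h1]
      refine (List.pairwise_append.2 ⟨(ih r (by omega) (by omega)).pairwise, by simp, ?_⟩).sortedLT
      intro a ha b hb
      rw [List.mem_singleton] at hb
      rw [mem_viewIdx_iff hs hpq (by omega)] at ha
      have := lt_of_mem_view ha
      omega

theorem map_ptr_sub (u : PSeq M) (K L : List ℕ) (hL : ∀ i ∈ L, i < u.length) :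
    (L.filterMap fun i => (u[i]?).map fun x => (⟨x.move, K.idxOf x.ptr⟩ : PMove M)).map PMove.ptr =
      L.map fun i => K.idxOf (u.ptrAt i) := by
  induction L with
  | nil => rfl
  | cons a L ih =>
    have ha := hL a List.mem_cons_self
    have ih := ih fun i hi => hL i (List.mem_cons_of_mem _ hi)
    rw [List.filterMap_cons_some (b := ⟨(u[a]).move, K.idxOf (u[a]).ptr⟩)
      (by rw [List.getElem?_eq_getElem ha]; rfl), List.map_cons, List.map_cons, ih, PSeq.ptrAt,
      List.getElem?_eq_getElem ha]
    rfl

theorem restricts_view (hs : A.IsPlay s) (hpq : p ≠ q) (hn : n ≤ s.length) :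
    Restricts (A.view p (s.take n)) (ptr s) (A.viewIdx p s n) := by
  refine ⟨sortedLT_viewIdx hs hpq hn, ?_⟩
  have hlen : (s.take n).length = n := by rw [List.length_take]; omega
  have hlt : ∀ i ∈ A.viewIdx p s n, i < n := fun i hi =>
    lt_of_mem_view ((mem_viewIdx_iff hs hpq hn i).1 hi)
  rw [Arena.view, hlen, viewIdx_take le_rfl, PSeq.sub,
    map_ptr_sub _ _ _ fun i hi => by rw [hlen]; exact hlt i hi]
  refine List.map_congr_left fun i hi => ?_
  have := hlt i hi
  rw [ptrAt_take this, ptr, if_pos (by omega)]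

theorem length_view_take (hs : A.IsPlay s) (hpq : p ≠ q) (hn : n ≤ s.length) :
    (A.view p (s.take n)).length = (view (ptr s) (moves (residue q)) n).card := by
  rw [(restricts_view hs hpq hn).length_eq,
    ← List.toFinset_card_of_nodup (sortedLT_viewIdx hs hpq hn).nodup]
  congr 1
  ext i
  rw [List.mem_toFinset, mem_viewIdx_iff hs hpq hn]

end Plays

/-! ### Bounds for interactions -/

section Strategies

variable {σ τ : Set (PSeq M)}

theorem ptr_mem_view_of_visible (hs : A.IsPlay s) (hpq : p ≠ q) (hσ : A.IsVisible p σ)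
    (hmem : ∀ i < s.length, i % 2 = residue p → s.take (i + 1) ∈ σ) (hi : i ∈ moves (residue p)) :
    ptr s i ∈ view (ptr s) (moves (residue q)) i := by
  by_cases h : i < s.length
  · have h1 := hmem i h hi.2
    rw [← List.take_concat_get' s i h] at h1
    have h2 := hσ _ _ h1 fun h0 => by
      have := congrArg List.length h0
      rw [List.length_take, List.length_nil] at this
      have := hi.1
      omega
    rw [List.length_take, min_eq_left h.le, viewIdx_take le_rfl] at h2
    rw [ptr_eq_of_lt h]
    exact (mem_viewIdx_iff hs hpq h.le _).1 h2
  · obtain ⟨j, rfl⟩ : ∃ j, i = j + 1 := ⟨i - 1, by have := hi.1; omega⟩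
    rw [show ptr s (j + 1) = j by rw [ptr, if_neg h]; omega]
    exact self_mem_view_succ

theorem visible_ptr (hs : A.IsPlay s) (hpq : p ≠ q) (hσ : A.IsVisible p σ) (hτ : A.IsVisible q τ)
    (hmemσ : ∀ i < s.length, i % 2 = residue p → s.take (i + 1) ∈ σ)
    (hmemτ : ∀ i < s.length, i % 2 = residue q → s.take (i + 1) ∈ τ) :
    Visible (ptr s) (residue p) (residue q) where
  add_eq := residue_add hpq
  ptr_lt _ hi := ptr_lt hs hi
  ptr_parity _ hi := ptr_parity hs hi
  mem_view _ hi := ptr_mem_view_of_visible hs hpq hσ hmemσ hi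
  mem_view' _ hi := ptr_mem_view_of_visible hs hpq.symm hτ hmemτ hi

theorem level_view_le (hσ : A.IsBounded p σ k) {u : PSeq M} (hu : u ∈ σ) :
    (A.view p u).level ≤ A.strategyLevel p σ :=
  le_csSup ⟨k, by rintro _ ⟨v, hv, rfl⟩; exact (level_le_length _).trans (hσ.2 v hv)⟩ ⟨u, hu, rfl⟩

/-- Formulated for either player, so that two applications give the minimum of the levels. The
alternative `l = 0 ∨ 2 ≤ k` disposes of small `k`, for which the counting and the comparison of the
two bounds are not available. -/
theorem length_le_of_bounded (hs : A.IsPlay s) (hpq : p ≠ q) (hσ : A.IsBounded p σ k)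
    (hτ : A.IsBounded q τ k)
    (hmemσ : ∀ i < s.length, i % 2 = residue p → s.take (i + 1) ∈ σ)
    (hmemτ : ∀ i < s.length, i % 2 = residue q → s.take (i + 1) ∈ τ) {l : ℕ}
    (hl : s.length = l + 1) : l ≤ hyperexp k k (A.strategyLevel p σ) ∧ (l = 0 ∨ 2 ≤ k) := by
  have hv := visible_ptr hs hpq hσ.1 hτ.1 hmemσ hmemτ
  have hk : ∀ j < l + 1, j % 2 = residue p →
      (view (ptr s) (moves (residue q)) (j + 1)).card ≤ k := fun j hj hjp => by
    rw [← length_view_take hs hpq (by omega)]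
    exact hσ.2 _ (hmemσ j (by omega) hjp)
  have hk' : ∀ j < l + 1, j % 2 = residue q →
      (view (ptr s) (moves (residue p)) (j + 1)).card ≤ k := fun j hj hjq => by
    rw [← length_view_take hs hpq.symm (by omega)]
    exact hτ.2 _ (hmemτ j (by omega) hjq)
  have h2 : l = 0 ∨ 2 ≤ k := by
    rcases Nat.eq_zero_or_pos l with h0 | h0
    · exact .inl h0
    · right
      have hadd := residue_add hpq
      -- Player's view after the second move of the interaction consists of the first two moves.
      have h1 : (view (ptr s) (moves 0) (1 + 1)).card ≤ k := by
        rcases Nat.eq_zero_or_pos (residue p) with hp | hp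
        · rw [← hp]
          exact hk' 1 (by omega) (by omega)
        · rw [show 0 = residue q by omega]
          exact hk 1 (by omega) (by omega)
      have h3 : (1 : ℕ) ∉ moves 0 := fun h' => by have := h'.2; omega
      have h4 : (0 : ℕ) ∈ view (ptr s) (moves 0) (1 + 1) := by
        rw [view_succ_of_notMem h3]
        exact Finset.mem_insert_of_mem self_mem_view_succ
      exact (Finset.one_lt_card.2 ⟨0, h4, 1, self_mem_view_succ, by omega⟩).trans_le h1
  refine ⟨?_, h2⟩
  rcases h2 with rfl | h2
  · exact Nat.zero_le _
  · refine hv.length_le_hyperexp (fun j hj hjl => hk j hjl hj.2) h2 hk' fun e he hel => ?_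
    refine (restricts_view hs hpq (n := e + 1) (by omega)).ptr_succ_eq hv
      (mem_viewIdx_iff hs hpq (by omega)) (level_view_le hσ ?_) he
    exact hmemσ e (by omega) (iterate_der_subset _ he).2

theorem take_mem_of_closed (hσ : A.IsStrategy p σ) {u : PSeq M} (hu : u ∈ σ)
    (h : u.length = i + 2 * m) : u.take i ∈ σ := by
  induction m generalizing u with
  | zero => rwa [List.take_of_length_le (by omega)]
  | succ m ih =>
    obtain ⟨a, b, hab⟩ := List.length_eq_two.1
      (show (u.drop (i + 2 * m)).length = 2 by rw [List.length_drop]; omega)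
    have h1 := u.take_append_drop (i + 2 * m)
    rw [hab] at h1
    have h2 : u.take (i + 2 * m) ∈ σ := hσ.closed _ a b (by rwa [h1])
    have h3 := ih h2 (by rw [List.length_take]; omega)
    rwa [List.take_take, min_eq_left (by omega)] at h3

theorem mod_length_of_mem (hσ : A.IsStrategy p σ) {u : PSeq M} (hu : u ∈ σ) :
    (u.length + 1) % 2 = residue p := by
  have := hσ.parity u hu
  cases p
  · have := Nat.even_iff.1 this
    simp only [residue]; omega
  · have := Nat.odd_iff.1 this
    simp only [residue]; omega

theorem take_mem_of_mod_eq (hσ : A.IsStrategy p σ) {u v : PSeq M} (hu : u ∈ σ) (huv : u <+: v)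
    (hi : i < u.length) (hip : i % 2 = residue p) : v.take (i + 1) ∈ σ := by
  have h1 := mod_length_of_mem hσ hu
  have h2 : v.take (i + 1) = u.take (i + 1) := by
    obtain ⟨w, rfl⟩ := huv
    rw [List.take_append_of_le_length (by omega)]
  rw [h2]
  exact take_mem_of_closed hσ hu (m := (u.length - (i + 1)) / 2) (by omega)

/-- The initial segments of an interaction that end with a move of a player belong to the strategy
of that player. -/
theorem of_mem_interactions (hσ : A.IsStrategy Polarity.P σ) (hτ : A.IsStrategy Polarity.O τ)
    (hs : s ∈ A.interactions σ τ) : A.IsPlay s ∧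
      (∀ i < s.length, i % 2 = residue Polarity.P → s.take (i + 1) ∈ σ) ∧
      (∀ i < s.length, i % 2 = residue Polarity.O → s.take (i + 1) ∈ τ) := by
  obtain ⟨u, x, rfl, hP, hO⟩ := hs
  have hpre : u <+: u ++ [x] := List.prefix_append _ _
  have hlen : (u ++ [x]).length = u.length + 1 := by simp
  have key : ∀ {p q : Polarity} {σ τ : Set (PSeq M)}, A.IsStrategy p σ → A.IsStrategy q τ →
      u ++ [x] ∈ σ → u ∈ τ → A.IsPlay (u ++ [x]) ∧
      (∀ i < (u ++ [x]).length, i % 2 = residue p → (u ++ [x]).take (i + 1) ∈ σ) ∧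
      (∀ i < (u ++ [x]).length, i % 2 = residue q → (u ++ [x]).take (i + 1) ∈ τ) := by
    intro p q σ τ hσ hτ h1 h2
    refine ⟨hσ.isPlay _ h1, fun i hi hip => take_mem_of_mod_eq hσ h1 List.prefix_rfl hi hip,
      fun i hi hiq => take_mem_of_mod_eq hτ h2 hpre ?_ hiq⟩
    -- By parity the last move of the interaction belongs to the other strategy, so `i` is an index
    -- in `u`.
    have := mod_length_of_mem hτ h2
    omega
  cases hx : A.pol x.move with
  | P =>
    obtain ⟨h1, h2⟩ := hP hx
    exact key hσ hτ h1 h2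
  | O =>
    obtain ⟨h1, h2⟩ := hO hx
    obtain ⟨h3, h4, h5⟩ := key hτ hσ h1 h2
    exact ⟨h3, h5, h4⟩

end Strategies

/-! ### Comparison of the two hyperexponential bounds -/

section Hyperexp

theorem hyperexp_nonneg {a x : ℝ} (ha : 0 ≤ a) (hx : 0 ≤ x) (b : ℕ) : 0 ≤ hyperexp a x b := by
  cases b with
  | zero => exact hx
  | succ b => exact Real.rpow_nonneg ha _

theorem two_le_hyperexp (hk : 2 ≤ k) (b : ℕ) : 2 ≤ hyperexp k k b := by
  induction b with
  | zero => exact hk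
  | succ b ih => exact hk.trans (Nat.le_self_pow (by omega) k)

/-- The factor `2 * Real.logb 2 k` strengthens the inequality so that induction applies: it starts
with equality, and at each step the factor is absorbed by one more copy of `2 ^ (x * y)`. -/
theorem two_mul_hyperexp_mul_logb_le (hk : 2 ≤ k) (b : ℕ) :
    2 * ((hyperexp k k b : ℕ) * Real.logb 2 k) ≤
      hyperexp (2 : ℝ) (2 * (k * Real.logb 2 k)) b := by
  have hk0 : (0 : ℝ) < k := by exact_mod_cast (by omega : 0 < k)
  have hx : 1 ≤ Real.logb 2 k := by
    rw [Real.le_logb_iff_rpow_le (by norm_num) hk0, Real.rpow_one]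
    exact_mod_cast hk
  induction b with
  | zero => exact le_rfl
  | succ b ih =>
    set x := Real.logb 2 k with hxdef
    set y := ((hyperexp k k b : ℕ) : ℝ) with hy
    have hy2 : (2 : ℝ) ≤ y := by rw [hy]; exact_mod_cast two_le_hyperexp hk b
    have hkx : (2 : ℝ) ^ x = k := Real.rpow_logb (by norm_num) (by norm_num) hk0
    -- Bernoulli's inequality gives `1 + x ≤ 2 ^ x`, hence `2 * x ≤ (2 ^ x) ^ 2`; and `y ≥ 2`.
    have hself : 2 * x ≤ (2 : ℝ) ^ (x * y) := by
      have h1 := one_add_mul_self_le_rpow_one_add (s := 1) (by norm_num) hx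
      rw [mul_one, one_add_one_eq_two] at h1
      calc 2 * x ≤ (2 : ℝ) ^ x * (2 : ℝ) ^ x := by nlinarith
        _ = (2 : ℝ) ^ (x * 2) := by rw [← Real.rpow_add (by norm_num), mul_two]
        _ ≤ (2 : ℝ) ^ (x * y) :=
          Real.rpow_le_rpow_of_exponent_le (by norm_num) (by nlinarith)
    have h1 : ((hyperexp k k (b + 1) : ℕ) : ℝ) = (2 : ℝ) ^ (x * y) := by
      rw [Real.rpow_mul (by norm_num), hkx, hy, Real.rpow_natCast]
      exact Nat.cast_pow k _
    have h2 : hyperexp (2 : ℝ) (2 * (k * x)) (b + 1) =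
      (2 : ℝ) ^ hyperexp (2 : ℝ) (2 * (k * x)) b := rfl
    rw [h1, h2]
    calc 2 * ((2 : ℝ) ^ (x * y) * x) = (2 : ℝ) ^ (x * y) * (2 * x) := by ring
      _ ≤ (2 : ℝ) ^ (x * y) * (2 : ℝ) ^ (x * y) :=
        mul_le_mul_of_nonneg_left hself (by positivity)
      _ = (2 : ℝ) ^ (2 * (y * x)) := by rw [← Real.rpow_add (by norm_num)]; ring_nf
      _ ≤ _ := Real.rpow_le_rpow_of_exponent_le (by norm_num) ih

theorem hyperexp_le_hyperexp_two (hk : 2 ≤ k) (b : ℕ) :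
    ((hyperexp k k b : ℕ) : ℝ) ≤ hyperexp (2 : ℝ) (2 * (k * Real.logb 2 k)) b := by
  refine le_trans ?_ (two_mul_hyperexp_mul_logb_le hk b)
  have hx : 1 ≤ Real.logb 2 k := by
    rw [Real.le_logb_iff_rpow_le (by norm_num) (by exact_mod_cast (by omega : 0 < k)),
      Real.rpow_one]
    exact_mod_cast hk
  have : (0 : ℝ) ≤ (hyperexp k k b : ℕ) := Nat.cast_nonneg _
  nlinarith

end Hyperexp

end Backtracking

open Backtracking in
theorem mainTheorem1 {M : Type*} (A : Arena M) (σ τ : Set (PSeq M)) (n m k : ℕ)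
    (hσ : A.IsStrategy Polarity.P σ) (hσk : A.IsBounded Polarity.P σ k)
    (hn : A.strategyLevel Polarity.P σ = n)
    (hτ : A.IsStrategy Polarity.O τ) (hτk : A.IsBounded Polarity.O τ k)
    (hm : A.strategyLevel Polarity.O τ = m)
    (s : PSeq M) (hs : s ∈ A.interactions σ τ) (l : ℕ) (hl : s.length = l + 1) :
    l ≤ hyperexp k k (min n m) ∧
    (l : ℝ) ≤ hyperexp (2 : ℝ) (2 * (k * Real.logb 2 k)) (min n m) ∧
    (2 ≤ k → ((hyperexp k k (min n m) : ℕ) : ℝ) ≤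
      hyperexp (2 : ℝ) (2 * (k * Real.logb 2 k)) (min n m)) := by
  obtain ⟨hplay, hP, hO⟩ := of_mem_interactions hσ hτ hs
  obtain ⟨h1, hk⟩ := length_le_of_bounded hplay (by decide) hσk hτk hP hO hl
  obtain ⟨h2, -⟩ := length_le_of_bounded hplay (by decide) hτk hσk hO hP hl
  rw [hn] at h1
  rw [hm] at h2
  have h : l ≤ hyperexp k k (min n m) := by
    rcases min_choice n m with h' | h' <;> rw [h'] <;> assumption
  refine ⟨h, ?_, fun hk => hyperexp_le_hyperexp_two hk _⟩
  -- For `k < 2` the comparison of the two towers is not at hand, but then `l = 0` and nonnegativity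
  -- suffices.
  rcases hk with rfl | hk
  · rw [Nat.cast_zero]
    have : 0 ≤ Real.logb 2 (k : ℝ) := by
      rcases Nat.eq_zero_or_pos k with rfl | hk
      · simp
      · exact Real.logb_nonneg (by norm_num) (by exact_mod_cast hk)
    exact hyperexp_nonneg (by norm_num) (by positivity) _
  · exact (Nat.cast_le.2 h).trans (hyperexp_le_hyperexp_two hk _)
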